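/- Let $S\subseteq\mathbb R^n$ and $\Xi\subseteq\mathbb R^m$ be closed convex sets, let $f(x,\xi)\in[0,\infty)$ for $x\in S$, $\xi\in\Xi$, with $f(x,\cdot)$ measurable on $\Xi$ for each $x\in S$, and let $\mu_0\in\Xi$, $\Sigma_0\in\mathbb R^{m\times m}$ symmetric positive definite, $\gamma_1\ge 0$, $\gamma_2\ge 1$. If $\gamma_1=0$, assume moreover that $\mu_0$ lies in the relative interior of $\Xi$. Let $\mathscr P$ be the set of Borel probability measures $P$ on $\mathbb R^m$ with $P(\Xi)=1$, finite second moments, and $$(\mathbb E_P[\xi]-\mu_0)^\top\Sigma_0^{-1}(\mathbb E_P[\xi]-\mu_0)\le\gamma_1,\qquad \mathbb E_P[(\xi-\mu_0)(\xi-\mu_0)^\top]\preceq\gamma_2\Sigma_0 .$$ Then the distributionally robust problem $$\text{(DRERM)}\qquad \min_{x\in S}\ \Psi(x),\qquad \Psi(x):=\sup_{P\in\mathscr P}\mathbb E_P[f(x,\xi)]\in[0,+\infty],$$ is equivalent to the following semi-infinite program with a second-order cone constraint, in the variables $x\in\mathbb R^n$, $y_0\in\mathbb R$, $y\in\mathbb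 R^m$, $Y\in\mathbb R^{m\times m}$ symmetric, $z_0\in\mathbb R$: $$\text{(SIP)}\qquad\begin{array}{rl}\min & y_0+z_0+\mu_0^\top y+\langle \gamma_2\Sigma_0+\mu_0\mu_0^\top,\,Y\rangle\\ \text{s.t.}& z_0\ge\sqrt{\gamma_1}\,\bigl\|\Sigma_0^{1/2}(y+2Y\mu_0)\bigr\|,\\ & \xi^\top Y\xi+\xi^\top y+y_0\ge f(x,\xi)\quad\text{for all }\xi\in\Xi,\\ & x\in S,\quad Y\succeq 0,\end{array}$$ where $\langle A,B\rangle=\operatorname{tr}(AB)$ and $\|\cdot\|$ is the Euclidean norm. Precisely: 1. the optimal values (infima in $[-\infty,+\infty]$) of (DRERM) and (SIP) are equal; 2. for every $x\in S$, $\Psi(x)$ equals the infimum of the (SIP) objective over the $(y_0,y,Y,z_0)$ feasible together with $x$, and this infimum is attained if $\Psi(x)<+\infty$; 3. if $(x,y_0,y,Y,z_0)$ is a global optimum of (SIP), then $x$ is a global optimum of (DRERM); conversely, if $x$ is a global optimum of (DRERM) with $\Psi(x)<+\infty$, then there is $(y_0,y,Y,z_0)$ such that $(x,y_0,y,Y,z_0)$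 is a global optimum of (SIP). -/

import Mathlib

open MeasureTheory Matrix
open scoped MatrixOrder ENNReal

noncomputable section

namespace DRERM

/-- The moment ambiguity set: Borel probability measures `P` on `ℝᵐ` with `P(Ξ) = 1`, with finite
second moments (so that the mean and the second-moment matrix exist), with mean in the ellipsoid
`(E_P[ξ] - μ₀)ᵀ Sig₀⁻¹ (E_P[ξ] - μ₀) ≤ γ₁`, and with
`E_P[(ξ - μ₀)(ξ - μ₀)ᵀ] ⪯ γ₂ Sig₀`. -/
def ambiguitySet {m : ℕ} (Ξ : Set (EuclideanSpace ℝ (Fin m))) (μ₀ : EuclideanSpace ℝ (Fin m))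
    (Sig₀ : Matrix (Fin m) (Fin m) ℝ) (γ₁ γ₂ : ℝ) :
    Set (Measure (EuclideanSpace ℝ (Fin m))) :=
  {P | IsProbabilityMeasure P ∧ P Ξ = 1 ∧
    MemLp (fun ξ : EuclideanSpace ℝ (Fin m) => ξ) 2 P ∧
    ((∫ ξ, ξ ∂P) - μ₀).ofLp ⬝ᵥ (Sig₀⁻¹ *ᵥ ((∫ ξ, ξ ∂P) - μ₀).ofLp) ≤ γ₁ ∧
    (γ₂ • Sig₀ - Matrix.of fun i j => ∫ ξ, (ξ i - μ₀ i) * (ξ j - μ₀ j) ∂P).PosSemidef}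

/-- The objective `x ↦ sup_{P ∈ Pset} E_P[f(x, ξ)]`, for residuals that are nonnegative on the
support of every `P ∈ Pset`. The expectation of a nonnegative residual is its Lebesgue integral, with
value `+∞` allowed. -/
def worstCase {n m : ℕ} (Pset : Set (Measure (EuclideanSpace ℝ (Fin m))))
    (f : EuclideanSpace ℝ (Fin n) → EuclideanSpace ℝ (Fin m) → ℝ)
    (x : EuclideanSpace ℝ (Fin n)) : EReal :=
  ⨆ P ∈ Pset, ((∫⁻ ξ, ENNReal.ofReal (f x ξ) ∂P : ℝ≥0∞) : EReal)

/-- The variables `(x, y₀, y, Y, z₀)` of the semi-infinite program. Symmetry of `Y` is imposed in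
the feasible set, as part of `Matrix.PosSemidef`. -/
structure SIPVar (n m : ℕ) where
  x : EuclideanSpace ℝ (Fin n)
  y₀ : ℝ
  y : EuclideanSpace ℝ (Fin m)
  Y : Matrix (Fin m) (Fin m) ℝ
  z₀ : ℝ

/-- The objective `y₀ + z₀ + μ₀ᵀ y + ⟨γ₂ Sig₀ + μ₀ μ₀ᵀ, Y⟩`. -/
def sipObjective {n m : ℕ} (μ₀ : EuclideanSpace ℝ (Fin m)) (Sig₀ : Matrix (Fin m) (Fin m) ℝ)
    (γ₂ : ℝ) (v : SIPVar n m) : ℝ :=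
  v.y₀ + v.z₀ + μ₀.ofLp ⬝ᵥ v.y.ofLp +
    ((γ₂ • Sig₀ + Matrix.vecMulVec μ₀.ofLp μ₀.ofLp) * v.Y).trace

/-- The feasible set of the semi-infinite program. `CFC.sqrt Sig₀` is the positive semidefinite
square root of `Sig₀`, and the norm is the Euclidean one. -/
def sipFeasible {n m : ℕ} (S : Set (EuclideanSpace ℝ (Fin n)))
    (Ξ : Set (EuclideanSpace ℝ (Fin m)))
    (f : EuclideanSpace ℝ (Fin n) → EuclideanSpace ℝ (Fin m) → ℝ)
    (μ₀ : EuclideanSpace ℝ (Fin m)) (Sig₀ : Matrix (Fin m) (Fin m) ℝ) (γ₁ : ℝ) :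
    Set (SIPVar n m) :=
  {v | √γ₁ * ‖WithLp.toLp 2 (CFC.sqrt Sig₀ *ᵥ (v.y.ofLp + (2 : ℝ) • (v.Y *ᵥ μ₀.ofLp)))‖ ≤ v.z₀ ∧
    (∀ ξ ∈ Ξ, f v.x ξ ≤ ξ.ofLp ⬝ᵥ (v.Y *ᵥ ξ.ofLp) + ξ.ofLp ⬝ᵥ v.y.ofLp + v.y₀) ∧
    v.x ∈ S ∧ v.Y.PosSemidef}

end DRERM

end

/-!
Fix `x ∈ S`. After centring at `μ₀`, the inner problem is a moment problem: maximize the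
expectation of `g u = f x (μ₀ + u)` over probability measures on `K = Ξ - μ₀` with mean in an
ellipsoid and second moment at most `γ₂ Sig₀`. The semi-infinite program is its Lagrange dual, and
everything reduces to two inequalities.

* Weak duality (`worstCase_le_sipObjective`). The constraint of the program says that a quadratic
  function majorizes `f x` on `Ξ`. Its expectation is linear in the mean and the second moment,
  and is bounded by `trace_mul_nonneg` (the trace of a product of positive semidefinite matrices
  is nonnegative) and the Cauchy-Schwarz inequality `dotProduct_le_of_ellipsoid`.
* Strong duality with attainment (`exists_feasible_sipObjective_le`). The convex hull of the
  points `((u, u uᵀ), g u)`, `u ∈ K`, consists of the moments of finitely supported measures. Such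
  a measure that satisfies the constraints belongs to the ambiguity set, so the hull lies below
  the worst case `V` over the admissible moments. A nonvertical hyperplane that separates the two
  (`exists_linear_of_convex`, an application of the M. Riesz extension theorem,
  `exists_multipliers`) gives `Y` and `w = y + 2 Y μ₀`, and the ellipsoid constraint becomes the
  cone constraint on `z₀` because the support function of the ellipsoid is attained
  (`exists_mem_ellipsoid_dotProduct`).

The hyperplane is nonvertical because of a Slater condition. For the second moment it is `0 ≺ γ₂
Sig₀`, the Dirac measure at `μ₀` being strictly feasible. For the mean it holds when `γ₁ > 0`
since the ellipsoid is a neighbourhood of `0`, and when `γ₁ = 0` since `μ₀` is a relative interior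
point of `Ξ`; `exists_qualified_mean_set` treats the two cases uniformly.
-/

namespace DRERM

open Filter Topology Pointwise

variable {n m : ℕ}

/-! ### Quadratic forms and positive semidefinite matrices -/

theorem dotProduct_mulVec_eq_trace (Y : Matrix (Fin m) (Fin m) ℝ) (v : Fin m → ℝ) :
    v ⬝ᵥ (Y *ᵥ v) = (Y * vecMulVec v v).trace := by
  rw [mul_vecMulVec, trace_vecMulVec, dotProduct_comm]

theorem trace_mul_nonneg {A B : Matrix (Fin m) (Fin m) ℝ} (hA : A.PosSemidef)
    (hB : B.PosSemidef) : 0 ≤ (A * B).trace := by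
  have hs : (CFC.sqrt B).PosSemidef := nonneg_iff_posSemidef.1 (CFC.sqrt_nonneg B)
  have h2 : CFC.sqrt B * CFC.sqrt B = B := CFC.sqrt_mul_sqrt_self B hB.nonneg
  have h := (hA.conjTranspose_mul_mul_same (CFC.sqrt B)).trace_nonneg
  rw [hs.isHermitian.eq] at h
  rwa [← h2, ← mul_assoc, trace_mul_comm, ← mul_assoc]

theorem abs_dotProduct_mulVec_le (M : Matrix (Fin m) (Fin m) ℝ) (v : Fin m → ℝ) :
    |v ⬝ᵥ (M *ᵥ v)| ≤ (∑ i, ∑ j, |M i j|) * (v ⬝ᵥ v) := by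
  have hvi : ∀ i, v i ^ 2 ≤ v ⬝ᵥ v := fun i => by
    have := Finset.single_le_sum (f := fun i => v i * v i) (fun i _ => mul_self_nonneg (v i))
      (Finset.mem_univ i)
    simpa [dotProduct, sq] using this
  have hform : v ⬝ᵥ (M *ᵥ v) = ∑ i, ∑ j, v i * (M i j * v j) := by
    simp [dotProduct, mulVec, Finset.mul_sum]
  rw [hform, Finset.sum_mul]
  refine (Finset.abs_sum_le_sum_abs _ _).trans (Finset.sum_le_sum fun i _ => ?_)
  rw [Finset.sum_mul]
  refine (Finset.abs_sum_le_sum_abs _ _).trans (Finset.sum_le_sum fun j _ => ?_)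
  have hij : |v i * v j| ≤ v ⬝ᵥ v := by
    rw [abs_le]
    constructor <;> nlinarith [hvi i, hvi j, sq_nonneg (v i + v j), sq_nonneg (v i - v j)]
  calc |v i * (M i j * v j)| = |M i j| * |v i * v j| := by rw [← abs_mul]; ring_nf
    _ ≤ |M i j| * (v ⬝ᵥ v) := mul_le_mul_of_nonneg_left hij (abs_nonneg _)

theorem sqrt_mul_sqrt {R : Matrix (Fin m) (Fin m) ℝ} (hR : R.PosDef) :
    CFC.sqrt R * CFC.sqrt R = R :=
  CFC.sqrt_mul_sqrt_self R hR.posSemidef.nonneg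

theorem transpose_sqrt (R : Matrix (Fin m) (Fin m) ℝ) : (CFC.sqrt R)ᵀ = CFC.sqrt R := by
  have hs : (CFC.sqrt R).PosSemidef := nonneg_iff_posSemidef.1 (CFC.sqrt_nonneg R)
  simpa [conjTranspose_eq_transpose_of_trivial] using hs.isHermitian.eq

theorem isUnit_det_sqrt {R : Matrix (Fin m) (Fin m) ℝ} (hR : R.PosDef) :
    IsUnit (CFC.sqrt R).det := by
  have h : IsUnit (CFC.sqrt R * CFC.sqrt R).det := by
    rw [sqrt_mul_sqrt hR]; exact (isUnit_iff_isUnit_det _).1 hR.isUnit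
  rw [det_mul] at h
  exact isUnit_of_mul_isUnit_left h

theorem norm_toLp_sq (v : Fin m → ℝ) : ‖WithLp.toLp 2 v‖ ^ 2 = v ⬝ᵥ v := by
  rw [EuclideanSpace.real_norm_sq_eq]
  simp [dotProduct, sq]

theorem dotProduct_le_norm_mul_norm (v w : Fin m → ℝ) :
    v ⬝ᵥ w ≤ ‖WithLp.toLp 2 v‖ * ‖WithLp.toLp 2 w‖ := by
  have h := real_inner_le_norm (WithLp.toLp 2 w : EuclideanSpace ℝ (Fin m)) (WithLp.toLp 2 v)
  rw [mul_comm] at h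
  simpa [PiLp.inner_apply, dotProduct] using h

theorem norm_sqrt_mulVec_sq {R : Matrix (Fin m) (Fin m) ℝ} (hR : R.PosDef) (v : Fin m → ℝ) :
    ‖WithLp.toLp 2 (CFC.sqrt R *ᵥ v)‖ ^ 2 = v ⬝ᵥ (R *ᵥ v) := by
  rw [norm_toLp_sq, dotProduct_mulVec, ← mulVec_transpose, transpose_sqrt, mulVec_mulVec,
    sqrt_mul_sqrt hR, dotProduct_comm]

theorem norm_inv_sqrt_mulVec_sq {R : Matrix (Fin m) (Fin m) ℝ} (hR : R.PosDef) (v : Fin m → ℝ) :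
    ‖WithLp.toLp 2 ((CFC.sqrt R)⁻¹ *ᵥ v)‖ ^ 2 = v ⬝ᵥ (R⁻¹ *ᵥ v) := by
  rw [hR.posSemidef.inv_sqrt, norm_sqrt_mulVec_sq hR.inv]

/-- The form of a positive definite matrix dominates every quadratic form up to a constant. -/
theorem exists_abs_form_le {R : Matrix (Fin m) (Fin m) ℝ} (hR : R.PosDef)
    (M : Matrix (Fin m) (Fin m) ℝ) :
    ∃ C : ℝ, 0 ≤ C ∧ ∀ v : Fin m → ℝ, |v ⬝ᵥ (M *ᵥ v)| ≤ C * (v ⬝ᵥ (R *ᵥ v)) := by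
  have h0 : ∀ A : Matrix (Fin m) (Fin m) ℝ, 0 ≤ ∑ i, ∑ j, |A i j| := fun A => by positivity
  refine ⟨(∑ i, ∑ j, |M i j|) * ∑ i, ∑ j, |R⁻¹ i j|, mul_nonneg (h0 _) (h0 _), fun v => ?_⟩
  -- `|v|²` is the value of the form of `R⁻¹` at `R^{1/2} v`, whose squared norm is `vᵀ R v`.
  have h1 := abs_dotProduct_mulVec_le R⁻¹ (CFC.sqrt R *ᵥ v)
  rw [← norm_inv_sqrt_mulVec_sq hR, mulVec_mulVec, nonsing_inv_mul _ (isUnit_det_sqrt hR),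
    one_mulVec, norm_toLp_sq, ← norm_toLp_sq (CFC.sqrt R *ᵥ v), norm_sqrt_mulVec_sq hR] at h1
  calc |v ⬝ᵥ (M *ᵥ v)| ≤ (∑ i, ∑ j, |M i j|) * (v ⬝ᵥ v) := abs_dotProduct_mulVec_le M v
    _ ≤ (∑ i, ∑ j, |M i j|) * ((∑ i, ∑ j, |R⁻¹ i j|) * (v ⬝ᵥ (R *ᵥ v))) :=
        mul_le_mul_of_nonneg_left ((le_abs_self _).trans h1) (h0 _)
    _ = _ := by ring

/-- `w ⬝ᵥ d` is bounded on the ellipsoid `dᵀ R⁻¹ d ≤ γ` by `√γ ‖R^{1/2} w‖`. -/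
theorem dotProduct_le_of_ellipsoid {R : Matrix (Fin m) (Fin m) ℝ} (hR : R.PosDef) {γ : ℝ}
    {d : Fin m → ℝ} (hd : d ⬝ᵥ (R⁻¹ *ᵥ d) ≤ γ) (w : Fin m → ℝ) :
    w ⬝ᵥ d ≤ √γ * ‖WithLp.toLp 2 (CFC.sqrt R *ᵥ w)‖ := by
  have h1 : w ⬝ᵥ d = (CFC.sqrt R *ᵥ w) ⬝ᵥ ((CFC.sqrt R)⁻¹ *ᵥ d) := by
    rw [dotProduct_comm (CFC.sqrt R *ᵥ w), dotProduct_mulVec, ← mulVec_transpose, transpose_sqrt,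
      mulVec_mulVec, mul_nonsing_inv _ (isUnit_det_sqrt hR), one_mulVec, dotProduct_comm]
  have h2 : ‖WithLp.toLp 2 ((CFC.sqrt R)⁻¹ *ᵥ d)‖ ≤ √γ :=
    Real.le_sqrt_of_sq_le (by rwa [norm_inv_sqrt_mulVec_sq hR])
  rw [h1, mul_comm]
  exact (dotProduct_le_norm_mul_norm _ _).trans (mul_le_mul_of_nonneg_left h2 (norm_nonneg _))

/-- The bound of `dotProduct_le_of_ellipsoid` is attained. -/
theorem exists_mem_ellipsoid_dotProduct {R : Matrix (Fin m) (Fin m) ℝ} (hR : R.PosDef) {γ : ℝ}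
    (hγ : 0 ≤ γ) (w : Fin m → ℝ) :
    ∃ d : Fin m → ℝ, d ⬝ᵥ (R⁻¹ *ᵥ d) ≤ γ ∧
      w ⬝ᵥ d = √γ * ‖WithLp.toLp 2 (CFC.sqrt R *ᵥ w)‖ := by
  -- If `R^{1/2} w = 0` then division by zero gives `c = 0`, and the witness is `d = 0`.
  set s := ‖WithLp.toLp 2 (CFC.sqrt R *ᵥ w)‖ with hs
  set c := √γ / s with hc
  have hw : w ⬝ᵥ (R *ᵥ w) = s ^ 2 := (norm_sqrt_mulVec_sq hR w).symm
  have hunit : IsUnit R.det := (isUnit_iff_isUnit_det _).1 hR.isUnit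
  refine ⟨c • (R *ᵥ w), ?_, ?_⟩
  · rw [mulVec_smul, mulVec_mulVec, nonsing_inv_mul _ hunit, one_mulVec, smul_dotProduct,
      dotProduct_smul, dotProduct_comm, hw, smul_eq_mul, smul_eq_mul]
    rcases eq_or_ne s 0 with h | h
    · simp [h, hγ]
    · rw [hc]; field_simp; rw [Real.sq_sqrt hγ]
  · rw [dotProduct_smul, hw, smul_eq_mul]
    rcases eq_or_ne s 0 with h | h
    · simp [h]
    · rw [hc]; field_simp

theorem convex_ellipsoid {R : Matrix (Fin m) (Fin m) ℝ} (hR : R.PosDef) {γ : ℝ} (hγ : 0 ≤ γ) :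
    Convex ℝ {d : Fin m → ℝ | d ⬝ᵥ (R⁻¹ *ᵥ d) ≤ γ} := by
  have h : {d : Fin m → ℝ | d ⬝ᵥ (R⁻¹ *ᵥ d) ≤ γ} =
      ((WithLp.linearEquiv 2 ℝ (Fin m → ℝ)).symm.toLinearMap ∘ₗ (CFC.sqrt R)⁻¹.mulVecLin) ⁻¹'
        Metric.closedBall 0 (√γ) := by
    ext d
    simp only [Set.mem_ofPred_eq, Set.mem_preimage, mem_closedBall_zero_iff]
    rw [← norm_inv_sqrt_mulVec_sq hR, ← Real.le_sqrt (norm_nonneg _) hγ]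
    rfl
  rw [h]
  exact (convex_closedBall 0 _).linear_preimage _

/-! ### Nonvertical supporting hyperplanes -/

/-- A convex set `B` in `E × ℝ` that meets the vertical axis only at nonnegative heights, and whose
projection to `E` is absorbing, lies above the graph of a linear functional. Absorption excludes
vertical hyperplanes; no topology on `E` is needed, since the functional comes from the
M. Riesz extension theorem for the cone generated by `B`. -/
theorem exists_linear_of_convex {E : Type*} [AddCommGroup E] [Module ℝ E] {B : Set (E × ℝ)}
    (hB : Convex ℝ B) (h0 : ∀ τ, ((0 : E), τ) ∈ B → 0 ≤ τ)
    (habs : ∀ e : E, ∃ r : ℝ, 0 < r ∧ ∃ τ, (r • e, τ) ∈ B) :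
    ∃ φ : E →ₗ[ℝ] ℝ, ∀ b ∈ B, 0 ≤ φ b.1 + b.2 := by
  obtain ⟨r₀, -, τ₀, hb₀⟩ := habs 0
  let s : PointedCone ℝ (E × ℝ) :=
    { carrier := {p | ∃ r : ℝ, 0 ≤ r ∧ ∃ b ∈ B, r • b = p}
      zero_mem' := ⟨0, le_rfl, _, hb₀, by simp⟩
      smul_mem' := by
        rintro ⟨c, hc⟩ _ ⟨r, hr, b, hb, rfl⟩
        exact ⟨c * r, mul_nonneg hc hr, b, hb, mul_smul c r b⟩
      add_mem' := by
        rintro _ _ ⟨r, hr, b, hb, rfl⟩ ⟨q, hq, c, hc, rfl⟩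
        rcases (add_nonneg hr hq).eq_or_lt with h | h
        · obtain rfl : r = 0 := by linarith
          obtain rfl : q = 0 := by linarith
          exact ⟨0, le_rfl, b, hb, by simp⟩
        · refine ⟨r + q, h.le, (r / (r + q)) • b + (q / (r + q)) • c,
            hB hb hc (by positivity) (by positivity) (by field_simp), ?_⟩
          rw [smul_add, smul_smul, smul_smul]
          congr 2 <;> field_simp }
  have hs : ∀ p, p ∈ s ↔ ∃ r : ℝ, 0 ≤ r ∧ ∃ b ∈ B, r • b = p := fun p => Iff.rfl
  let f : (E × ℝ) →ₗ.[ℝ] ℝ :=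
    { domain := LinearMap.range (LinearMap.inr ℝ E ℝ)
      toFun := (LinearMap.snd ℝ E ℝ).domRestrict _ }
  have hnonneg : ∀ x : f.domain, (x : E × ℝ) ∈ s → 0 ≤ f x := by
    rintro ⟨_, τ, rfl⟩ hx
    obtain ⟨r, hr, b, hb, h⟩ := (hs _).1 hx
    have h1 : r • b.1 = 0 := congrArg Prod.fst h
    have h2 : r * b.2 = τ := congrArg Prod.snd h
    change 0 ≤ τ
    rcases hr.eq_or_lt with rfl | hr
    · simp [← h2]
    · have hb1 : b.1 = 0 := (smul_eq_zero.1 h1).resolve_left hr.ne'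
      have := h0 b.2 (by rw [← hb1]; exact hb)
      rw [← h2]; positivity
  have hdense : ∀ y, ∃ x : f.domain, (x : E × ℝ) + y ∈ s := by
    rintro ⟨e, t⟩
    obtain ⟨r, hr, τ, hb⟩ := habs e
    refine ⟨⟨(0, r⁻¹ * τ - t), _, rfl⟩, (hs _).2 ⟨r⁻¹, by positivity, _, hb, ?_⟩⟩
    ext
    · simp [smul_smul, hr.ne']
    · simp
  obtain ⟨g, hgf, hg⟩ := riesz_extension s f hnonneg hdense
  refine ⟨g ∘ₗ LinearMap.inl ℝ E ℝ, fun b hb => ?_⟩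
  have h1 := hg b ((hs b).2 ⟨1, zero_le_one, b, hb, one_smul _ _⟩)
  have h2 : g (0, b.2) = b.2 := hgf ⟨(0, b.2), b.2, rfl⟩
  have h3 : b = (b.1, 0) + (0, b.2) := by ext <;> simp
  rw [h3, map_add, h2] at h1
  exact h1

/-! ### Lagrange multipliers for the centred moment problem -/

theorem linearMap_apply_eq_dotProduct (φ : (Fin m → ℝ) →ₗ[ℝ] ℝ) (x : Fin m → ℝ) :
    φ x = (fun i => φ (Pi.single i 1)) ⬝ᵥ x := by
  rw [LinearMap.pi_apply_eq_sum_univ φ x, dotProduct]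
  refine Finset.sum_congr rfl fun i _ => ?_
  rw [smul_eq_mul, mul_comm]
  congr 2
  ext j
  simp [Pi.single_apply, eq_comm]

theorem linearMap_apply_eq_trace (φ : Matrix (Fin m) (Fin m) ℝ →ₗ[ℝ] ℝ)
    (X : Matrix (Fin m) (Fin m) ℝ) :
    φ X = ((Matrix.of fun i j => φ (Matrix.single j i 1)) * X).trace := by
  conv_lhs => rw [matrix_eq_sum_single X]
  have h : ∀ i j, φ (Matrix.single i j (X i j)) = φ (Matrix.single i j 1) * X i j := fun i j => by
    rw [mul_comm, ← smul_eq_mul, ← map_smul, Matrix.smul_single, smul_eq_mul, mul_one]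
  simp only [map_sum, h, trace, diag_apply, mul_apply, of_apply]
  exact Finset.sum_comm

/-- The points `((u, u uᵀ), g u)` for `u ∈ K`: their convex hull consists of the first moments,
second moments and expectations of `g` under the finitely supported probability measures on `K`. -/
def momentGraph (K : Set (Fin m → ℝ)) (g : (Fin m → ℝ) → ℝ) :
    Set (((Fin m → ℝ) × Matrix (Fin m) (Fin m) ℝ) × ℝ) :=
  (fun u => ((u, vecMulVec u u), g u)) '' K

/-- Existence of multipliers for the moment problem with mean in `D` and second moment at most `R`,
whose value over finitely supported measures is at most `V`. The hypothesis `habs` is the constraint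
qualification on the mean: small multiples of every vector are differences of points of `D` and of
`K`. For the second-moment constraint the strict inequality `0 ≺ R` at `u = 0` plays this part. -/
theorem exists_multipliers {K D : Set (Fin m → ℝ)} {g : (Fin m → ℝ) → ℝ}
    {R : Matrix (Fin m) (Fin m) ℝ} {V : ℝ} (hK : 0 ∈ K) (hD : Convex ℝ D) (hD0 : 0 ∈ D)
    (hR : R.PosDef)
    (habs : ∀ d : Fin m → ℝ, ∃ l : Fin m → ℝ, ∀ᶠ ε : ℝ in 𝓝[>] 0, ε • l ∈ K ∧ ε • (l + d) ∈ D)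
    (hV : ∀ q ∈ convexHull ℝ (momentGraph K g), q.1.1 ∈ D →
      (∀ v : Fin m → ℝ, 0 ≤ v ⬝ᵥ ((R - q.1.2) *ᵥ v)) → q.2 ≤ V) :
    ∃ (Y : Matrix (Fin m) (Fin m) ℝ) (w : Fin m → ℝ), Y.PosSemidef ∧
      ∀ u ∈ K, ∀ d ∈ D, g u + w ⬝ᵥ d + (Y * R).trace ≤ V + w ⬝ᵥ u + u ⬝ᵥ (Y *ᵥ u) := by
  set C : Set (Matrix (Fin m) (Fin m) ℝ) := {M | ∀ v : Fin m → ℝ, 0 ≤ v ⬝ᵥ ((R - M) *ᵥ v)} with hC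
  have hCconv : Convex ℝ C := by
    intro M hM N hN a b ha hb hab v
    have h : R - (a • M + b • N) = a • (R - M) + b • (R - N) := by
      have : R = a • R + b • R := by rw [← add_smul, hab, one_smul]
      conv_lhs => rw [this]
      module
    rw [h, add_mulVec, smul_mulVec, smul_mulVec, dotProduct_add, dotProduct_smul, dotProduct_smul]
    exact add_nonneg (mul_nonneg ha (hM v)) (mul_nonneg hb (hN v))
  obtain ⟨φ, hφ⟩ := exists_linear_of_convex
    (B := (D ×ˢ C) ×ˢ {V} - convexHull ℝ (momentGraph K g))
    (((hD.prod hCconv).prod (convex_singleton V)).sub (convex_convexHull ℝ _))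
    (by
      rintro τ ⟨⟨⟨d, M⟩, t⟩, ⟨⟨hd, hM⟩, rfl⟩, q, hq, h⟩
      have h1 : d = q.1.1 := sub_eq_zero.1 (congrArg (fun p => p.1.1) h)
      have h2 : M = q.1.2 := sub_eq_zero.1 (congrArg (fun p => p.1.2) h)
      have h3 : t - q.2 = τ := congrArg (fun p => p.2) h
      rw [← h3, sub_nonneg]
      exact hV q hq (h1 ▸ hd) (h2 ▸ hM))
    (by
      rintro ⟨d, M⟩
      obtain ⟨l, hl⟩ := habs d
      obtain ⟨C₁, hC₁, hM⟩ := exists_abs_form_le hR M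
      obtain ⟨C₂, hC₂, hl2⟩ := exists_abs_form_le hR (vecMulVec l l)
      have hsmall : ∀ᶠ ε : ℝ in 𝓝[>] 0, ε ∈ Set.Ioo 0 (1 / (1 + C₁ + C₂)) :=
        Ioo_mem_nhdsGT (by positivity)
      obtain ⟨ε, ⟨hεK, hεD⟩, hε0, hε⟩ := (hl.and hsmall).exists
      refine ⟨ε, hε0, V - g (ε • l), ((ε • (l + d), ε • M + vecMulVec (ε • l) (ε • l)), V),
        ⟨⟨hεD, fun v => ?_⟩, rfl⟩, _, subset_convexHull ℝ _ ⟨ε • l, hεK, rfl⟩, ?_⟩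
      · rw [lt_div_iff₀ (by positivity)] at hε
        have hε1 : ε ≤ 1 := by nlinarith [mul_nonneg hε0.le hC₁, mul_nonneg hε0.le hC₂]
        have hRv : 0 ≤ v ⬝ᵥ (R *ᵥ v) := by
          simpa using hR.posSemidef.dotProduct_mulVec_nonneg v
        have e : v ⬝ᵥ ((R - (ε • M + vecMulVec (ε • l) (ε • l))) *ᵥ v) =
            v ⬝ᵥ (R *ᵥ v) - ε * (v ⬝ᵥ (M *ᵥ v)) - ε ^ 2 * (v ⬝ᵥ (vecMulVec l l *ᵥ v)) := by
          rw [smul_vecMulVec, vecMulVec_smul, sub_mulVec, add_mulVec, smul_mulVec, smul_mulVec,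
            smul_mulVec, dotProduct_sub, dotProduct_add, dotProduct_smul, dotProduct_smul,
            dotProduct_smul, smul_eq_mul, smul_eq_mul, smul_eq_mul]
          ring
        have a1 : ε * (v ⬝ᵥ (M *ᵥ v)) ≤ ε * (C₁ * (v ⬝ᵥ (R *ᵥ v))) :=
          mul_le_mul_of_nonneg_left ((le_abs_self _).trans (hM v)) hε0.le
        have a2 : ε ^ 2 * (v ⬝ᵥ (vecMulVec l l *ᵥ v)) ≤ ε * (C₂ * (v ⬝ᵥ (R *ᵥ v))) := by
          have h1 := mul_le_mul_of_nonneg_left ((le_abs_self _).trans (hl2 v)) (sq_nonneg ε)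
          have h2 : ε ^ 2 ≤ ε := by nlinarith
          exact h1.trans (mul_le_mul_of_nonneg_right h2 (mul_nonneg hC₂ hRv))
        have a3 : 0 ≤ (1 - ε * (1 + C₁ + C₂)) * (v ⬝ᵥ (R *ᵥ v)) :=
          mul_nonneg (by linarith) hRv
        rw [e]
        nlinarith [mul_nonneg hε0.le hRv]
      · ext <;> simp)
  set φ₁ : (Fin m → ℝ) →ₗ[ℝ] ℝ := -(φ ∘ₗ LinearMap.inl ℝ _ _) with hφ₁
  set φ₂ : Matrix (Fin m) (Fin m) ℝ →ₗ[ℝ] ℝ := -(φ ∘ₗ LinearMap.inr ℝ _ _) with hφ₂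
  have hsplit : ∀ x X, φ (x, X) = -φ₁ x - φ₂ X := fun x X => by
    have : ((x, X) : (Fin m → ℝ) × Matrix (Fin m) (Fin m) ℝ) = (x, 0) + (0, X) := by simp
    rw [this, map_add]
    simp [hφ₁, hφ₂]
  have key : ∀ u ∈ K, ∀ d ∈ D, ∀ N : Matrix (Fin m) (Fin m) ℝ,
      (∀ v : Fin m → ℝ, 0 ≤ v ⬝ᵥ (N *ᵥ v)) →
      g u + φ₁ d + φ₂ R ≤ V + φ₁ u + φ₂ (vecMulVec u u) + φ₂ N := by
    intro u hu d hd N hN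
    have h := hφ _ (Set.sub_mem_sub (a := ((d, R - N), V))
      ⟨⟨hd, show R - N ∈ C by simpa [hC] using hN⟩, rfl⟩
      (subset_convexHull ℝ _ ⟨u, hu, rfl⟩))
    have h' : 0 ≤ φ (d - u, R - N - vecMulVec u u) + (V - g u) := h
    rw [hsplit] at h'
    simp only [map_sub] at h'
    linarith
  -- The constraint is stable under scaling `N`, so `φ₂` is nonnegative on these matrices.
  have hnn : ∀ N : Matrix (Fin m) (Fin m) ℝ, (∀ v : Fin m → ℝ, 0 ≤ v ⬝ᵥ (N *ᵥ v)) → 0 ≤ φ₂ N := by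
    intro N hN
    by_contra! hneg
    obtain ⟨k, hk⟩ := exists_nat_gt
      ((V + φ₁ 0 + φ₂ (vecMulVec 0 0) - (g 0 + φ₁ 0 + φ₂ R)) / (-φ₂ N))
    have h := key 0 hK 0 hD0 ((k : ℝ) • N) fun v => by
      rw [smul_mulVec, dotProduct_smul]
      exact mul_nonneg k.cast_nonneg (hN v)
    rw [div_lt_iff₀ (by linarith)] at hk
    rw [map_smul, smul_eq_mul] at h
    linarith
  set Y : Matrix (Fin m) (Fin m) ℝ := Matrix.of fun i j => φ₂ (Matrix.single j i 1) with hY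
  have hYtr : ∀ X, φ₂ X = (Y * X).trace := linearMap_apply_eq_trace φ₂
  -- Antisymmetric matrices have vanishing quadratic form, which makes `Y` symmetric.
  have hYle : ∀ i j, Y i j ≤ Y j i := fun i j => by
    have hs : ∀ (v : Fin m → ℝ) (i j : Fin m),
        v ⬝ᵥ (Matrix.single i j (1 : ℝ) *ᵥ v) = v i * v j := fun v i j => by
      rw [single_mulVec, one_mul]
      exact dotProduct_single v (v j) i
    have h := hnn (Matrix.single i j 1 - Matrix.single j i 1) fun v => by
      rw [sub_mulVec, dotProduct_sub, hs, hs, mul_comm, sub_self]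
    rw [map_sub] at h
    simpa [hY] using h
  refine ⟨Y, fun i => φ₁ (Pi.single i 1), .of_dotProduct_mulVec_nonneg ?_ fun v => ?_,
    fun u hu d hd => ?_⟩
  · ext i j
    simpa using le_antisymm (hYle j i) (hYle i j)
  · rw [star_trivial, dotProduct_mulVec_eq_trace, ← hYtr]
    refine hnn _ fun v' => ?_
    have := (posSemidef_vecMulVec_self_star v).dotProduct_mulVec_nonneg v'
    simpa using this
  · rw [← linearMap_apply_eq_dotProduct, ← linearMap_apply_eq_dotProduct, ← hYtr,
      dotProduct_mulVec_eq_trace, ← hYtr]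
    simpa using key u hu d hd 0 (by simp)

/-! ### Finitely supported measures -/

section Discrete

variable {α ι : Type*} [MeasurableSpace α] [Fintype ι]

/-- The measure `∑ i, p i • δ_{z i}`. -/
noncomputable def discreteMeasure (p : ι → ℝ) (z : ι → α) : Measure α :=
  ∑ i, ENNReal.ofReal (p i) • Measure.dirac (z i)

theorem lintegral_discreteMeasure [MeasurableSingletonClass α] (p : ι → ℝ) (z : ι → α)
    (F : α → ℝ≥0∞) :
    ∫⁻ a, F a ∂discreteMeasure p z = ∑ i, ENNReal.ofReal (p i) * F (z i) := by
  simp [discreteMeasure, lintegral_finsetSum_measure, lintegral_smul_measure]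

theorem discreteMeasure_eq_one {p : ι → ℝ} (hp : ∀ i, 0 ≤ p i) (hp1 : ∑ i, p i = 1) {z : ι → α}
    {s : Set α} (hz : ∀ i, z i ∈ s) : discreteMeasure p z s = 1 := by
  simp [discreteMeasure, hz, ← ENNReal.ofReal_sum_of_nonneg fun i _ => hp i, hp1]

theorem integrable_discreteMeasure [MeasurableSingletonClass α] {G : Type*}
    [NormedAddCommGroup G] (p : ι → ℝ) (z : ι → α)
    (F : α → G) : Integrable F (discreteMeasure p z) :=
  integrable_finsetSum_measure.2 fun _ _ =>
    (integrable_dirac (by simp)).smul_measure ENNReal.ofReal_ne_top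

theorem integral_discreteMeasure [MeasurableSingletonClass α] {G : Type*} [NormedAddCommGroup G]
    [NormedSpace ℝ G]
    [CompleteSpace G] {p : ι → ℝ} (hp : ∀ i, 0 ≤ p i) (z : ι → α) (F : α → G) :
    ∫ a, F a ∂discreteMeasure p z = ∑ i, p i • F (z i) := by
  rw [discreteMeasure, integral_finsetSum_measure fun i _ =>
    (integrable_dirac (by simp)).smul_measure ENNReal.ofReal_ne_top]
  simp [integral_smul_measure, ENNReal.toReal_ofReal, hp]

end Discrete

/-! ### The objective and the majorant in centred coordinates -/

theorem quadratic_recentre {Y : Matrix (Fin m) (Fin m) ℝ} (hY : Yᵀ = Y) (a u y : Fin m → ℝ)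
    (c : ℝ) :
    (a + u) ⬝ᵥ (Y *ᵥ (a + u)) + (a + u) ⬝ᵥ y + c =
      u ⬝ᵥ (Y *ᵥ u) + (y + (2 : ℝ) • (Y *ᵥ a)) ⬝ᵥ u + (c + a ⬝ᵥ y + a ⬝ᵥ (Y *ᵥ a)) := by
  have h : a ⬝ᵥ (Y *ᵥ u) = u ⬝ᵥ (Y *ᵥ a) := by
    rw [dotProduct_mulVec, ← mulVec_transpose, hY, dotProduct_comm]
  rw [mulVec_add, add_dotProduct, dotProduct_add, dotProduct_add, add_dotProduct, add_dotProduct,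
    smul_dotProduct, h, dotProduct_comm y u, dotProduct_comm (Y *ᵥ a) u, smul_eq_mul]
  ring

theorem sipObjective_eq (μ₀ : EuclideanSpace ℝ (Fin m)) (Sig₀ : Matrix (Fin m) (Fin m) ℝ) (γ₂ : ℝ)
    (v : SIPVar n m) :
    sipObjective μ₀ Sig₀ γ₂ v =
      (v.y₀ + μ₀.ofLp ⬝ᵥ v.y.ofLp + μ₀.ofLp ⬝ᵥ (v.Y *ᵥ μ₀.ofLp)) + v.z₀ +
        (v.Y * (γ₂ • Sig₀)).trace := by
  rw [sipObjective, add_mul, trace_add, dotProduct_mulVec_eq_trace, trace_mul_comm v.Y,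
    trace_mul_comm v.Y]
  ring

/-! ### Weak duality -/

theorem form_eq_sum (Y : Matrix (Fin m) (Fin m) ℝ) (u : Fin m → ℝ) :
    u ⬝ᵥ (Y *ᵥ u) = ∑ i, ∑ j, Y i j * (u j * u i) := by
  simp only [dotProduct, mulVec, Finset.mul_sum]
  exact Finset.sum_congr rfl fun i _ => Finset.sum_congr rfl fun j _ => by ring

section Moments

variable {P : Measure (EuclideanSpace ℝ (Fin m))} [IsProbabilityMeasure P]

theorem integrable_mul_sub (hP : MemLp (fun ξ : EuclideanSpace ℝ (Fin m) => ξ) 2 P)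
    (a : EuclideanSpace ℝ (Fin m)) (i j : Fin m) :
    Integrable (fun ξ : EuclideanSpace ℝ (Fin m) => (ξ i - a i) * (ξ j - a j)) P :=
  ((hP.eval_piLp i).sub (memLp_const (a i))).integrable_mul
    ((hP.eval_piLp j).sub (memLp_const (a j)))

theorem integrable_coord (hP : MemLp (fun ξ : EuclideanSpace ℝ (Fin m) => ξ) 2 P) (i : Fin m) :
    Integrable (fun ξ : EuclideanSpace ℝ (Fin m) => ξ i) P :=
  (hP.eval_piLp i).integrable one_le_two

/-- The expectation of a quadratic function in terms of the mean and the second-moment matrix. -/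
theorem integrable_and_integral_quadratic
    (hP : MemLp (fun ξ : EuclideanSpace ℝ (Fin m) => ξ) 2 P) (a : EuclideanSpace ℝ (Fin m))
    (Y : Matrix (Fin m) (Fin m) ℝ) (w : Fin m → ℝ) (c : ℝ) :
    Integrable (fun ξ : EuclideanSpace ℝ (Fin m) =>
        (ξ - a).ofLp ⬝ᵥ (Y *ᵥ (ξ - a).ofLp) + w ⬝ᵥ (ξ - a).ofLp + c) P ∧
      ∫ ξ, ((ξ - a).ofLp ⬝ᵥ (Y *ᵥ (ξ - a).ofLp) + w ⬝ᵥ (ξ - a).ofLp + c) ∂P =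
        (Y * Matrix.of fun i j => ∫ ξ, (ξ i - a i) * (ξ j - a j) ∂P).trace +
          w ⬝ᵥ ((∫ ξ, ξ ∂P) - a).ofLp + c := by
  have hi1 : ∀ i, Integrable (fun ξ : EuclideanSpace ℝ (Fin m) => w i * (ξ i - a i)) P := fun i =>
    ((integrable_coord hP i).sub (integrable_const _)).const_mul _
  have hqij : ∀ i j, Integrable (fun ξ : EuclideanSpace ℝ (Fin m) =>
      Y i j * ((ξ j - a j) * (ξ i - a i))) P := fun i j =>
    (integrable_mul_sub hP a j i).const_mul _
  have hqi : ∀ i, Integrable (fun ξ : EuclideanSpace ℝ (Fin m) =>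
      ∑ j, Y i j * ((ξ j - a j) * (ξ i - a i))) P := fun i =>
    integrable_finsetSum _ fun j _ => hqij i j
  have hq : Integrable (fun ξ : EuclideanSpace ℝ (Fin m) =>
      ∑ i, ∑ j, Y i j * ((ξ j - a j) * (ξ i - a i))) P :=
    integrable_finsetSum _ fun i _ => hqi i
  have hl : Integrable (fun ξ : EuclideanSpace ℝ (Fin m) => ∑ i, w i * (ξ i - a i)) P :=
    integrable_finsetSum _ fun i _ => hi1 i
  simp only [form_eq_sum]
  simp only [dotProduct, PiLp.sub_apply]
  have hql : Integrable (fun ξ : EuclideanSpace ℝ (Fin m) =>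
      ∑ i, ∑ j, Y i j * ((ξ j - a j) * (ξ i - a i)) + ∑ i, w i * (ξ i - a i)) P := hq.add hl
  refine ⟨hql.add (integrable_const c), ?_⟩
  rw [integral_add hql (integrable_const c), integral_add hq hl,
    integral_finsetSum _ fun i _ => hqi i, integral_finsetSum _ fun i _ => hi1 i]
  congr 1
  · congr 1
    · simp only [trace, diag_apply, mul_apply, of_apply]
      refine Finset.sum_congr rfl fun i _ => ?_
      rw [integral_finsetSum _ fun j _ => hqij i j]
      exact Finset.sum_congr rfl fun j _ => integral_const_mul _ _
    · refine Finset.sum_congr rfl fun i _ => ?_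
      rw [integral_const_mul, integral_sub (integrable_coord hP i) (integrable_const _),
        eval_integral_piLp (integrable_coord hP)]
      simp
  · simp

end Moments

/-- Every feasible point of the semi-infinite program bounds the worst case: integrating the
quadratic majorant, the second-moment constraint is paired with `Y ⪰ 0` and the mean constraint
with the gradient `y + 2 Y μ₀` of the majorant at `μ₀`. The integral of the majorant is a Bochner
integral, and its comparison with the Lebesgue integral of `f` uses that the majorant is
nonnegative on `Ξ`. -/
theorem worstCase_le_sipObjective {S : Set (EuclideanSpace ℝ (Fin n))}
    {Ξ : Set (EuclideanSpace ℝ (Fin m))} (hΞ : IsClosed Ξ)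
    {f : EuclideanSpace ℝ (Fin n) → EuclideanSpace ℝ (Fin m) → ℝ}
    (hf : ∀ x ∈ S, ∀ ξ ∈ Ξ, 0 ≤ f x ξ) {μ₀ : EuclideanSpace ℝ (Fin m)}
    {Sig₀ : Matrix (Fin m) (Fin m) ℝ} (hSig₀ : Sig₀.PosDef) {γ₁ γ₂ : ℝ} {v : SIPVar n m}
    (hv : v ∈ sipFeasible S Ξ f μ₀ Sig₀ γ₁) :
    worstCase (ambiguitySet Ξ μ₀ Sig₀ γ₁ γ₂) f v.x ≤ (sipObjective μ₀ Sig₀ γ₂ v : EReal) := by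
  obtain ⟨hz, hmaj, hxS, hY⟩ := hv
  have hYs : v.Yᵀ = v.Y := by
    simpa [conjTranspose_eq_transpose_of_trivial] using hY.isHermitian.eq
  refine iSup₂_le fun P hP => ?_
  obtain ⟨hprob, hPΞ, hL2, hmean, hcov⟩ := hP
  have hae : ∀ᵐ ξ ∂P, ξ ∈ Ξ := (mem_ae_iff_prob_eq_one hΞ.measurableSet).2 hPΞ
  set w := v.y.ofLp + (2 : ℝ) • (v.Y *ᵥ μ₀.ofLp) with hw
  set c := v.y₀ + μ₀.ofLp ⬝ᵥ v.y.ofLp + μ₀.ofLp ⬝ᵥ (v.Y *ᵥ μ₀.ofLp) with hc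
  have hmaj' : ∀ ξ ∈ Ξ, f v.x ξ ≤
      (ξ - μ₀).ofLp ⬝ᵥ (v.Y *ᵥ (ξ - μ₀).ofLp) + w ⬝ᵥ (ξ - μ₀).ofLp + c := fun ξ hξ => by
    have h := quadratic_recentre hYs μ₀.ofLp (ξ - μ₀).ofLp v.y.ofLp v.y₀
    have e : μ₀.ofLp + (ξ - μ₀).ofLp = ξ.ofLp := by simp
    rw [e] at h
    rw [← h]
    exact hmaj ξ hξ
  obtain ⟨hint, hval⟩ := integrable_and_integral_quadratic hL2 μ₀ v.Y w c
  have hq0 := hae.mono fun ξ hξ => (hf _ hxS ξ hξ).trans (hmaj' ξ hξ)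
  have hbound : ∫ ξ, ((ξ - μ₀).ofLp ⬝ᵥ (v.Y *ᵥ (ξ - μ₀).ofLp) + w ⬝ᵥ (ξ - μ₀).ofLp + c) ∂P ≤
      sipObjective μ₀ Sig₀ γ₂ v := by
    rw [hval, sipObjective_eq, ← hc]
    have h1 := trace_mul_nonneg hY hcov
    rw [mul_sub, trace_sub] at h1
    have h2 := (dotProduct_le_of_ellipsoid hSig₀ hmean w).trans hz
    linarith
  have hJ : 0 ≤ sipObjective μ₀ Sig₀ γ₂ v := (integral_nonneg_of_ae hq0).trans hbound
  have hle : ∫⁻ ξ, ENNReal.ofReal (f v.x ξ) ∂P ≤ ENNReal.ofReal (sipObjective μ₀ Sig₀ γ₂ v) := by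
    calc ∫⁻ ξ, ENNReal.ofReal (f v.x ξ) ∂P
        ≤ ∫⁻ ξ, ENNReal.ofReal ((ξ - μ₀).ofLp ⬝ᵥ (v.Y *ᵥ (ξ - μ₀).ofLp) +
            w ⬝ᵥ (ξ - μ₀).ofLp + c) ∂P :=
          lintegral_mono_ae (hae.mono fun ξ hξ => ENNReal.ofReal_le_ofReal (hmaj' ξ hξ))
      _ = ENNReal.ofReal (∫ ξ, ((ξ - μ₀).ofLp ⬝ᵥ (v.Y *ᵥ (ξ - μ₀).ofLp) +
            w ⬝ᵥ (ξ - μ₀).ofLp + c) ∂P) :=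
          (ofReal_integral_eq_lintegral_ofReal hint hq0).symm
      _ ≤ ENNReal.ofReal (sipObjective μ₀ Sig₀ γ₂ v) := ENNReal.ofReal_le_ofReal hbound
  calc ((∫⁻ ξ, ENNReal.ofReal (f v.x ξ) ∂P : ℝ≥0∞) : EReal)
      ≤ (ENNReal.ofReal (sipObjective μ₀ Sig₀ γ₂ v) : EReal) :=
        EReal.coe_ennreal_le_coe_ennreal_iff.2 hle
    _ = (sipObjective μ₀ Sig₀ γ₂ v : EReal) := by
        rw [EReal.coe_ennreal_ofReal, max_eq_left hJ]

/-! ### Finitely supported measures in the ambiguity set -/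

theorem discreteMeasure_mem_ambiguitySet {ι : Type*} [Fintype ι] {p : ι → ℝ} {u : ι → Fin m → ℝ}
    {Ξ : Set (EuclideanSpace ℝ (Fin m))} {μ₀ : EuclideanSpace ℝ (Fin m)}
    {Sig₀ : Matrix (Fin m) (Fin m) ℝ} (hSig₀ : Sig₀.PosDef) {γ₁ γ₂ : ℝ}
    (hp : ∀ i, 0 ≤ p i) (hp1 : ∑ i, p i = 1)
    (hu : ∀ i, μ₀ + WithLp.toLp 2 (u i) ∈ Ξ)
    (hmean : (∑ i, p i • u i) ⬝ᵥ (Sig₀⁻¹ *ᵥ ∑ i, p i • u i) ≤ γ₁)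
    (hcov : ∀ v : Fin m → ℝ,
      0 ≤ v ⬝ᵥ ((γ₂ • Sig₀ - ∑ i, p i • vecMulVec (u i) (u i)) *ᵥ v)) :
    discreteMeasure p (fun i => μ₀ + WithLp.toLp 2 (u i)) ∈ ambiguitySet Ξ μ₀ Sig₀ γ₁ γ₂ := by
  have hm : ((∫ ξ, ξ ∂discreteMeasure p (fun i => μ₀ + WithLp.toLp 2 (u i))) - μ₀).ofLp =
      ∑ i, p i • u i := by
    rw [integral_discreteMeasure hp]
    simp [smul_add, Finset.sum_add_distrib, ← Finset.sum_smul, hp1]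
  refine ⟨⟨discreteMeasure_eq_one hp hp1 fun _ => Set.mem_univ _⟩,
    discreteMeasure_eq_one hp hp1 hu,
    (memLp_two_iff_integrable_sq_norm measurable_id.aestronglyMeasurable).2
      (integrable_discreteMeasure _ _ _), by rwa [hm], ?_⟩
  have hc : (Matrix.of fun i j => ∫ ξ, (ξ i - μ₀ i) * (ξ j - μ₀ j)
      ∂discreteMeasure p (fun i => μ₀ + WithLp.toLp 2 (u i))) =
      ∑ i, p i • vecMulVec (u i) (u i) := by
    ext i j
    rw [of_apply, integral_discreteMeasure hp, Matrix.sum_apply]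
    simp [vecMulVec_apply]
  rw [hc]
  refine .of_dotProduct_mulVec_nonneg ?_ fun v => by simpa using hcov v
  ext i j
  have h := hSig₀.isHermitian.apply i j
  simp only [star_trivial] at h
  simp [Matrix.sum_apply, vecMulVec_apply, h, mul_comm]

/-! ### The constraint qualification on the mean -/

/-- Near a relative interior point, small displacements in the linear span of the displacements
into `Ξ` stay in `Ξ`. -/
theorem eventually_add_smul_mem {Ξ : Set (EuclideanSpace ℝ (Fin m))}
    {μ₀ : EuclideanSpace ℝ (Fin m)} (hμ₀ : μ₀ ∈ intrinsicInterior ℝ Ξ) {l : Fin m → ℝ}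
    (hl : l ∈ Submodule.span ℝ {u : Fin m → ℝ | μ₀ + WithLp.toLp 2 u ∈ Ξ}) :
    ∀ᶠ ε : ℝ in 𝓝[>] 0, μ₀ + WithLp.toLp 2 (ε • l) ∈ Ξ := by
  obtain ⟨y, hy, rfl⟩ := mem_intrinsicInterior.1 hμ₀
  set e := (WithLp.linearEquiv 2 ℝ (Fin m → ℝ)).symm with he
  have hdir : e l ∈ (affineSpan ℝ Ξ).direction := by
    have : Submodule.span ℝ {u : Fin m → ℝ | (y : EuclideanSpace ℝ (Fin m)) +
        WithLp.toLp 2 u ∈ Ξ} ≤ (affineSpan ℝ Ξ).direction.comap e.toLinearMap := by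
      refine Submodule.span_le.2 fun u hu => ?_
      have h := AffineSubspace.vsub_mem_direction (subset_affineSpan ℝ Ξ hu) y.2
      change e u ∈ (affineSpan ℝ Ξ).direction
      simpa [he] using h
    exact this hl
  let F : ℝ → affineSpan ℝ Ξ := fun ε => ⟨ε • e l +ᵥ (y : EuclideanSpace ℝ (Fin m)),
    AffineSubspace.vadd_mem_of_mem_direction (Submodule.smul_mem _ ε hdir) y.2⟩
  have hF : Continuous F := by
    refine Continuous.subtype_mk ?_ _
    simp only [vadd_eq_add]
    fun_prop
  have hF0 : F 0 = y := by ext1; simp [F]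
  have h := hF.continuousAt (x := 0) (by rw [hF0]; exact mem_interior_iff_mem_nhds.1 hy)
  refine (Filter.Eventually.filter_mono nhdsWithin_le_nhds h).mono fun ε hε => ?_
  have h' : ε • e l + (y : EuclideanSpace ℝ (Fin m)) ∈ Ξ := hε
  rw [add_comm] at h'
  simpa [he] using h'

/-- A convex set `D` that can replace the ellipsoid `dᵀ Sig₀⁻¹ d ≤ γ₁` in the mean constraint and
satisfies the constraint qualification of `exists_multipliers`. For `γ₁ > 0` it is the ellipsoid,
which is a neighbourhood of `0`. For `γ₁ = 0` it is a complement of the span of the displacements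
`ξ - μ₀`, `ξ ∈ Ξ`: means lie in the span, so on them membership in `D` still forces `d = 0`. -/
theorem exists_qualified_mean_set {Ξ : Set (EuclideanSpace ℝ (Fin m))}
    {μ₀ : EuclideanSpace ℝ (Fin m)} (hμ₀ : μ₀ ∈ Ξ) {Sig₀ : Matrix (Fin m) (Fin m) ℝ}
    (hSig₀ : Sig₀.PosDef) {γ₁ : ℝ} (hγ₁ : 0 ≤ γ₁)
    (hri : γ₁ = 0 → μ₀ ∈ intrinsicInterior ℝ Ξ) :
    ∃ D : Set (Fin m → ℝ), Convex ℝ D ∧ 0 ∈ D ∧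
      (∀ d : Fin m → ℝ, ∃ l : Fin m → ℝ, ∀ᶠ ε : ℝ in 𝓝[>] 0,
        ε • l ∈ {u : Fin m → ℝ | μ₀ + WithLp.toLp 2 u ∈ Ξ} ∧ ε • (l + d) ∈ D) ∧
      (∀ d ∈ Submodule.span ℝ {u : Fin m → ℝ | μ₀ + WithLp.toLp 2 u ∈ Ξ}, d ∈ D →
        d ⬝ᵥ (Sig₀⁻¹ *ᵥ d) ≤ γ₁) ∧
      ∀ w : Fin m → ℝ, ∃ d ∈ D, w ⬝ᵥ d = √γ₁ * ‖WithLp.toLp 2 (CFC.sqrt Sig₀ *ᵥ w)‖ := by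
  rcases hγ₁.eq_or_lt with rfl | hpos
  · obtain ⟨D, hD⟩ := Submodule.exists_isCompl
      (Submodule.span ℝ {u : Fin m → ℝ | μ₀ + WithLp.toLp 2 u ∈ Ξ})
    refine ⟨D, D.convex, D.zero_mem, fun d => ?_, fun d hd hdD => ?_, fun w => ⟨0, D.zero_mem, ?_⟩⟩
    · obtain ⟨a, b, ha, hb, rfl⟩ := Submodule.codisjoint_iff_exists_add_eq.1 hD.codisjoint d
      refine ⟨-a, (eventually_add_smul_mem (hri rfl) (Submodule.neg_mem _ ha)).mono
        fun ε hε => ⟨hε, ?_⟩⟩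
      rw [neg_add_cancel_left]
      exact D.smul_mem ε hb
    · rw [Submodule.disjoint_def.1 hD.disjoint d hd hdD]
      simp
    · simp
  · refine ⟨{d | d ⬝ᵥ (Sig₀⁻¹ *ᵥ d) ≤ γ₁}, convex_ellipsoid hSig₀ hγ₁, by simpa using hγ₁,
      fun d => ⟨0, ?_⟩, fun d _ hd => hd, fun w => exists_mem_ellipsoid_dotProduct hSig₀ hγ₁ w⟩
    have hcont : Continuous fun ε : ℝ => (ε • d) ⬝ᵥ (Sig₀⁻¹ *ᵥ (ε • d)) := by
      simp only [mulVec_smul, dotProduct_smul, smul_dotProduct]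
      fun_prop
    have h0 : ∀ᶠ ε : ℝ in 𝓝 0, (ε • d) ⬝ᵥ (Sig₀⁻¹ *ᵥ (ε • d)) < γ₁ :=
      hcont.continuousAt.eventually_lt_const (by simpa using hpos)
    refine (Filter.Eventually.filter_mono nhdsWithin_le_nhds h0).mono fun ε hε => ⟨?_, ?_⟩
    · simpa using hμ₀
    · rw [zero_add]
      exact hε.le

/-! ### Strong duality with attainment -/

/-- A finite bound on the worst case is achieved by a feasible point with the same decision `x`. The
bound is needed only for the finitely supported measures of the ambiguity set. -/
theorem exists_feasible_sipObjective_le {S : Set (EuclideanSpace ℝ (Fin n))}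
    {Ξ : Set (EuclideanSpace ℝ (Fin m))}
    {f : EuclideanSpace ℝ (Fin n) → EuclideanSpace ℝ (Fin m) → ℝ}
    (hf : ∀ x ∈ S, ∀ ξ ∈ Ξ, 0 ≤ f x ξ) {μ₀ : EuclideanSpace ℝ (Fin m)} (hμ₀ : μ₀ ∈ Ξ)
    {Sig₀ : Matrix (Fin m) (Fin m) ℝ} (hSig₀ : Sig₀.PosDef) {γ₁ γ₂ : ℝ} (hγ₁ : 0 ≤ γ₁)
    (hγ₂ : 0 < γ₂) (hri : γ₁ = 0 → μ₀ ∈ intrinsicInterior ℝ Ξ)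
    {x : EuclideanSpace ℝ (Fin n)} (hx : x ∈ S) {V : ℝ}
    (hV : worstCase (ambiguitySet Ξ μ₀ Sig₀ γ₁ γ₂) f x ≤ (V : EReal)) :
    ∃ v ∈ sipFeasible S Ξ f μ₀ Sig₀ γ₁, v.x = x ∧ sipObjective μ₀ Sig₀ γ₂ v ≤ V := by
  obtain ⟨D, hDconv, hD0, habs, hDmean, hDmax⟩ := exists_qualified_mean_set hμ₀ hSig₀ hγ₁ hri
  set K : Set (Fin m → ℝ) := {u | μ₀ + WithLp.toLp 2 u ∈ Ξ} with hK
  have hK0 : (0 : Fin m → ℝ) ∈ K := by simpa [hK] using hμ₀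
  obtain ⟨Y, w, hY, hYw⟩ := exists_multipliers (g := fun u => f x (μ₀ + WithLp.toLp 2 u))
    (R := γ₂ • Sig₀) (V := V) hK0 hDconv hD0 (hSig₀.smul hγ₂) habs (by
      intro q hq hqD hqR
      obtain ⟨ι, _, p, z, hp, hp1, hz, rfl⟩ := mem_convexHull_iff_exists_fintype.1 hq
      choose u hu huz using hz
      obtain rfl : _ = z := funext huz
      simp only [Prod.fst_sum, Prod.snd_sum, Prod.smul_mk, smul_eq_mul] at hqD hqR ⊢
      have hmem := discreteMeasure_mem_ambiguitySet (γ₂ := γ₂) hSig₀ hp hp1 hu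
        (hDmean _ (Submodule.sum_mem _ fun i _ =>
          Submodule.smul_mem _ _ (Submodule.subset_span (hu i))) hqD) hqR
      have h := (le_iSup₂ (f := fun P (_ : P ∈ ambiguitySet Ξ μ₀ Sig₀ γ₁ γ₂) =>
        ((∫⁻ ξ, ENNReal.ofReal (f x ξ) ∂P : ℝ≥0∞) : EReal)) _ hmem).trans hV
      have hpf : ∀ i, 0 ≤ p i * f x (μ₀ + WithLp.toLp 2 (u i)) := fun i =>
        mul_nonneg (hp i) (hf x hx _ (hu i))
      rw [lintegral_discreteMeasure] at h
      simp only [← ENNReal.ofReal_mul (hp _)] at h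
      rw [← ENNReal.ofReal_sum_of_nonneg fun i _ => hpf i, EReal.coe_ennreal_ofReal,
        EReal.coe_le_coe_iff] at h
      exact (le_max_left _ _).trans h)
  obtain ⟨d, hdD, hd⟩ := hDmax w
  have hYs : Yᵀ = Y := by
    simpa [conjTranspose_eq_transpose_of_trivial] using hY.isHermitian.eq
  -- In the coordinate `u = ξ - μ₀` the majorant is `uᵀ Y u + wᵀ u + c`. The point `d` attains the
  -- support function of the ellipsoid at `w`, so the objective is exactly `V`.
  set c := V - w ⬝ᵥ d - (Y * (γ₂ • Sig₀)).trace with hc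
  set y : Fin m → ℝ := w - (2 : ℝ) • (Y *ᵥ μ₀.ofLp) with hy
  have hyw : y + (2 : ℝ) • (Y *ᵥ μ₀.ofLp) = w := by rw [hy, sub_add_cancel]
  refine ⟨⟨x, c - μ₀.ofLp ⬝ᵥ y - μ₀.ofLp ⬝ᵥ (Y *ᵥ μ₀.ofLp), WithLp.toLp 2 y, Y, w ⬝ᵥ d⟩,
    ⟨?_, fun ξ hξ => ?_, hx, hY⟩, rfl, ?_⟩
  · change √γ₁ * ‖WithLp.toLp 2 (CFC.sqrt Sig₀ *ᵥ (y + (2 : ℝ) • (Y *ᵥ μ₀.ofLp)))‖ ≤ w ⬝ᵥ d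
    rw [hyw, hd]
  · have e : μ₀ + WithLp.toLp 2 (ξ - μ₀).ofLp = ξ := by simp
    have h := hYw (ξ - μ₀).ofLp (by rw [hK, Set.mem_ofPred_eq, e]; exact hξ) d hdD
    have h2 := quadratic_recentre hYs μ₀.ofLp (ξ - μ₀).ofLp y
      (c - μ₀.ofLp ⬝ᵥ y - μ₀.ofLp ⬝ᵥ (Y *ᵥ μ₀.ofLp))
    have e2 : μ₀.ofLp + (ξ - μ₀).ofLp = ξ.ofLp := by simp
    rw [hyw, e2] at h2
    rw [e] at h
    change f x ξ ≤ ξ.ofLp ⬝ᵥ (Y *ᵥ ξ.ofLp) + ξ.ofLp ⬝ᵥ y + _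
    rw [h2]
    linarith
  · rw [sipObjective_eq]
    change c - μ₀.ofLp ⬝ᵥ y - μ₀.ofLp ⬝ᵥ (Y *ᵥ μ₀.ofLp) + μ₀.ofLp ⬝ᵥ y +
      μ₀.ofLp ⬝ᵥ (Y *ᵥ μ₀.ofLp) + w ⬝ᵥ d + (Y * (γ₂ • Sig₀)).trace ≤ V
    linarith

end DRERM

theorem theorem1 {n m : ℕ}
    (S : Set (EuclideanSpace ℝ (Fin n))) (hS_closed : IsClosed S) (hS_convex : Convex ℝ S)
    (Ξ : Set (EuclideanSpace ℝ (Fin m))) (hΞ_closed : IsClosed Ξ) (hΞ_convex : Convex ℝ Ξ)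
    (f : EuclideanSpace ℝ (Fin n) → EuclideanSpace ℝ (Fin m) → ℝ)
    (hf_nonneg : ∀ x ∈ S, ∀ ξ ∈ Ξ, 0 ≤ f x ξ)
    (hf_meas : ∀ x ∈ S, Measurable (fun ξ : Ξ => f x ξ))
    (μ₀ : EuclideanSpace ℝ (Fin m)) (hμ₀ : μ₀ ∈ Ξ)
    (Sig₀ : Matrix (Fin m) (Fin m) ℝ) (hSig₀ : Sig₀.PosDef)
    (γ₁ γ₂ : ℝ) (hγ₁ : 0 ≤ γ₁) (hγ₂ : 1 ≤ γ₂)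
    (hri : γ₁ = 0 → μ₀ ∈ intrinsicInterior ℝ Ξ) :
    let Pset := DRERM.ambiguitySet Ξ μ₀ Sig₀ γ₁ γ₂
    let Ψ : EuclideanSpace ℝ (Fin n) → EReal := DRERM.worstCase Pset f
    let Feas : Set (DRERM.SIPVar n m) := DRERM.sipFeasible S Ξ f μ₀ Sig₀ γ₁
    let J : DRERM.SIPVar n m → ℝ := DRERM.sipObjective μ₀ Sig₀ γ₂
    -- the optimal values of the two programs agree
    (⨅ x ∈ S, Ψ x) = (⨅ v ∈ Feas, (J v : EReal)) ∧
    -- for each decision, minimizing over the other variables gives the worst-case expectation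
    (∀ x ∈ S, Ψ x = ⨅ v ∈ Feas, ⨅ _ : v.x = x, (J v : EReal)) ∧
    -- and this minimum is attained when it is finite
    (∀ x ∈ S, Ψ x < ⊤ → ∃ v ∈ Feas, v.x = x ∧ (J v : EReal) = Ψ x) ∧
    -- optimal solutions correspond
    (∀ v ∈ Feas, IsMinOn J Feas v → IsMinOn Ψ S v.x) ∧
    (∀ x ∈ S, Ψ x < ⊤ → IsMinOn Ψ S x → ∃ v ∈ Feas, v.x = x ∧ IsMinOn J Feas v) := by
  intro Pset Ψ Feas J
  have hweak : ∀ v ∈ Feas, Ψ v.x ≤ (J v : EReal) := fun v hv =>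
    DRERM.worstCase_le_sipObjective hΞ_closed hf_nonneg hSig₀ hv
  have hnonneg : ∀ x ∈ S, 0 ≤ Ψ x := by
    intro x hx
    have hmem : DRERM.discreteMeasure (fun _ : Unit => (1 : ℝ))
        (fun _ => μ₀ + WithLp.toLp 2 (0 : Fin m → ℝ)) ∈ Pset :=
      DRERM.discreteMeasure_mem_ambiguitySet hSig₀ (fun _ => zero_le_one) (by simp)
        (fun _ => by simpa using hμ₀) (by simpa using hγ₁) fun v => by
          have h := hSig₀.posSemidef.dotProduct_mulVec_nonneg v
          simp only [star_trivial] at h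
          simpa [smul_mulVec] using mul_nonneg (zero_le_one.trans hγ₂) h
    exact (EReal.coe_ennreal_nonneg _).trans (le_iSup₂ (f := fun P (_ : P ∈ Pset) =>
      ((∫⁻ ξ, ENNReal.ofReal (f x ξ) ∂P : ℝ≥0∞) : EReal)) _ hmem)
  have hattain : ∀ x ∈ S, Ψ x < ⊤ → ∃ v ∈ Feas, v.x = x ∧ (J v : EReal) = Ψ x := by
    intro x hx hlt
    have hV : ((Ψ x).toReal : EReal) = Ψ x :=
      EReal.coe_toReal hlt.ne ((EReal.bot_lt_zero.trans_le (hnonneg x hx)).ne')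
    obtain ⟨v, hv, hvx, hle⟩ := DRERM.exists_feasible_sipObjective_le hf_nonneg hμ₀ hSig₀ hγ₁
      (zero_lt_one.trans_le hγ₂) hri hx hV.ge
    refine ⟨v, hv, hvx, le_antisymm ?_ (hvx ▸ hweak v hv)⟩
    rw [← hV]
    exact EReal.coe_le_coe_iff.2 hle
  have hvalue : ∀ x ∈ S, Ψ x = ⨅ v ∈ Feas, ⨅ _ : v.x = x, (J v : EReal) := by
    intro x hx
    refine le_antisymm (le_iInf₂ fun v hv => le_iInf fun hvx => hvx ▸ hweak v hv) ?_
    rcases eq_or_lt_of_le (le_top : Ψ x ≤ ⊤) with h | h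
    · rw [h]
      exact le_top
    · obtain ⟨v, hv, hvx, hJ⟩ := hattain x hx h
      exact (iInf₂_le v hv).trans ((iInf_le _ hvx).trans hJ.le)
  have hopt : (⨅ x ∈ S, Ψ x) = ⨅ v ∈ Feas, (J v : EReal) := by
    refine le_antisymm (le_iInf₂ fun v hv => (iInf₂_le v.x hv.2.2.1).trans (hweak v hv))
      (le_iInf₂ fun x hx => ?_)
    rw [hvalue x hx]
    exact le_iInf₂ fun v hv => le_iInf fun _ => iInf₂_le v hv
  refine ⟨hopt, hvalue, hattain, fun v hv hmin x hx => ?_, fun x hx hlt hmin => ?_⟩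
  · change Ψ v.x ≤ Ψ x
    rw [hvalue x hx]
    exact le_iInf₂ fun u hu => le_iInf fun _ =>
      (hweak v hv).trans (EReal.coe_le_coe_iff.2 (hmin hu))
  · obtain ⟨v, hv, hvx, hJ⟩ := hattain x hx hlt
    refine ⟨v, hv, hvx, fun u hu => ?_⟩
    change J v ≤ J u
    rw [← EReal.coe_le_coe_iff, hJ]
    exact (hmin hu.2.2.1).trans (hweak u hu)
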